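/- Let $T=SO(2)\times\cdots\times SO(2)\subset O(2k)$ act on $\mathbf R^{2k}=\mathbf R^2\times\cdots\times\mathbf R^2$ by rotating each factor, and on $\mathbf R^{m+2k}=\{(x,u):x\in\mathbf R^m,\ u\in\mathbf R^{2k}\}$ through the second component. Its Lie algebra is $\mathfrak z=\mathfrak{so}(2)\oplus\cdots\oplus\mathfrak{so}(2)\simeq\mathbf R^k$, with exponential map $\exp:\mathfrak z\to T$ whose kernel is $(2\pi\mathbf Z)^k$; for $Z\in\mathfrak z$ put $Z^*_u=\frac{d}{dt}\big|_{t=0}\exp(tZ)u$. Given a bilinear map $[\cdot,\cdot]:\mathbf R^m\times\mathbf R^m\to\mathbf R^k=\mathfrak z$ and a smooth compactly supported function $\varphi:[0,\infty)\times[0,\infty)\to[0,\infty)$, let $g=g^{[\cdot,\cdot],\varphi}$ be the following Riemannian metric on $\mathbf R^{m+2k}$. For $p=(x,u)$ and $Y\in\mathbf R^m$ let $\tilde Y_p=\bigl(Y,\ \varphi(\|x\|^2,\|u\|^2)\,[x,Y]^*_u\bigr)\in T_p\mathbf R^{m+2k}$. Then $g_p((0,W),(0,V))=\langle W,V\rangle$,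 the $g_p$-orthogonal complement of $\{0\}\oplus\mathbf R^{2k}$ is $\{\tilde Y_p:Y\in\mathbf R^m\}$, and $g_p(\tilde Y_p,\tilde Y'_p)=\langle Y,Y'\rangle$. A pair $(A,C)$ with $A\in O(m)$ and $C\in O(k)$ is called an equivalence of $[\cdot,\cdot]$ and $[\cdot,\cdot]'$ if $C$ preserves the lattice $(2\pi\mathbf Z)^k$ and $\langle[Ax,Ay]',Z\rangle=\langle[x,y],CZ\rangle$ for all $x,y\in\mathbf R^m$ and $Z\in\mathbf R^k$. Fix such a $\varphi$, not identically zero, and let $g$ and $g'$ be the metrics defined by $\varphi$ and by nonzero bilinear maps $[\cdot,\cdot]$ and $[\cdot,\cdot]'$, respectively. **Proposition 4.6.** (i) Let $\tau$ be an isometry (a smooth diffeomorphism with $\tau^*g'=g$) from $(\mathbf R^{m+2k},g)$ to $(\mathbf R^{m+2k},g')$ that carries $T$-orbits to $T$-orbits. Then $\tau(x,u)=(Ax,\tilde Cu)$ for some $A\in O(m)$ and some $\tilde C\in O(2k)$ that normalizes $T$. Moreover, if $C$ is the automorphism $Z\mapsto\tilde CZ\tilde C^{-1}$ of $\mathfrak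 z=\mathbf R^k$, then $C\in O(k)$ and the pair $(A,C^{-1})$ is an equivalence of $[\cdot,\cdot]$ and $[\cdot,\cdot]'$; equivalently, $C$ preserves $(2\pi\mathbf Z)^k$ and $[Ax,Ay]'=C[x,y]$ for all $x,y\in\mathbf R^m$. (ii) Conversely, if $A\in O(m)$, if $\tilde C\in O(2k)$ normalizes $T$, and if $(A,C^{-1})$ is an equivalence of $[\cdot,\cdot]$ and $[\cdot,\cdot]'$, where $C$ is the automorphism $Z\mapsto\tilde CZ\tilde C^{-1}$ of $\mathfrak z$, then $(x,u)\mapsto(Ax,\tilde Cu)$ is an isometry from $(\mathbf R^{m+2k},g)$ to $(\mathbf R^{m+2k},g')$. -/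

import Mathlib

noncomputable section

open scoped ContDiff

/-- The base `ℝ^m` with its Euclidean inner product. -/
abbrev BaseSpc (m : ℕ) : Type := EuclideanSpace ℝ (Fin m)

/-- The fibre `ℝ^{2k} = ℝ² × ⋯ × ℝ²`, each factor `ℝ²` being written as `ℂ` (a real inner product
space), with the Euclidean inner product `⟨u, v⟩ = ∑ⱼ Re (conj uⱼ * vⱼ)`. -/
abbrev FibreSpc (k : ℕ) : Type := PiLp 2 (fun _ : Fin k => ℂ)

/-- The Lie algebra `𝔷 = 𝔰𝔬(2) ⊕ ⋯ ⊕ 𝔰𝔬(2) ≃ ℝ^k` of the torus. -/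
abbrev TorusLie (k : ℕ) : Type := EuclideanSpace ℝ (Fin k)

/-- The total space `ℝ^{m+2k}` with points `(x, u)`.  Only its structure as a smooth manifold is
used; the Riemannian metrics on it are defined below. -/
abbrev TotalSpc (m k : ℕ) : Type := BaseSpc m × FibreSpc k

/-- The standard representation `SO(2) × ⋯ × SO(2) → O(2k)`, each factor rotating one plane. -/
def torusRep (k : ℕ) : (Fin k → Circle) →* (FibreSpc k ≃ₗᵢ[ℝ] FibreSpc k) where
  toFun c := LinearIsometryEquiv.piLpCongrRight 2 (fun j => rotation (c j))
  map_one' := by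
    ext u j
    simp
  map_mul' c d := by
    ext u j
    simp

/-- The torus `T = SO(2) × ⋯ × SO(2)` as a subgroup of `O(2k)`. -/
def torus (k : ℕ) : Subgroup (FibreSpc k ≃ₗᵢ[ℝ] FibreSpc k) := (torusRep k).range

/-- The exponential map `𝔷 = ℝ^k → T ⊆ O(2k)`, with kernel `(2πℤ)^k`. -/
def torusExp {k : ℕ} (Z : TorusLie k) : FibreSpc k ≃ₗᵢ[ℝ] FibreSpc k :=
  torusRep k (fun j => Circle.exp (Z j))

/-- The vector field `Z^*_u = d/dt|_{t=0} exp(tZ) · u` on `ℝ^{2k}`. -/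
def fundField {k : ℕ} (Z : TorusLie k) (u : FibreSpc k) : FibreSpc k :=
  deriv (fun t : ℝ => torusExp (t • Z) u) 0

/-- The `T`-orbit of a point of `ℝ^{m+2k}`. -/
def torusOrbit {m k : ℕ} (p : TotalSpc m k) : Set (TotalSpc m k) :=
  {q | ∃ z ∈ torus k, q = (p.1, z p.2)}

/-- `τ` carries `T`-orbits to `T`-orbits. -/
def CarriesOrbits {m k : ℕ} (τ : TotalSpc m k → TotalSpc m k) : Prop :=
  ∀ p, ∃ q, τ '' torusOrbit p = torusOrbit q

/-- Smooth compactly supported functions `φ : [0,∞) × [0,∞) → [0,∞)`; the values of `φ` outside the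
closed quadrant are irrelevant. -/
structure IsCutoff (φ : ℝ → ℝ → ℝ) : Prop where
  smooth : ContDiffOn ℝ ∞ (fun p : ℝ × ℝ => φ p.1 p.2) (Set.Ici 0 ×ˢ Set.Ici 0)
  nonneg : ∀ s t : ℝ, 0 ≤ s → 0 ≤ t → 0 ≤ φ s t
  compact_support : ∃ K : Set (ℝ × ℝ), IsCompact K ∧
    ∀ s t : ℝ, 0 ≤ s → 0 ≤ t → (s, t) ∉ K → φ s t = 0

/-- Bilinear maps `ℝ^m × ℝ^m → ℝ^k`. -/
abbrev BilinBracket (m k : ℕ) : Type := BaseSpc m →ₗ[ℝ] BaseSpc m →ₗ[ℝ] TorusLie k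

/-- The second component `ψ(x,u) [x,Y]^*_u` of the lift of `Y`, where `ψ(x,u) = φ(‖x‖², ‖u‖²)`. -/
def liftFibre {m k : ℕ} (br : BilinBracket m k) (φ : ℝ → ℝ → ℝ) (p : TotalSpc m k) (Y : BaseSpc m) :
    FibreSpc k :=
  φ (‖p.1‖ ^ 2) (‖p.2‖ ^ 2) • fundField (br p.1 Y) p.2

/-- The Riemannian metric `g^{[,],φ}` on `ℝ^{m+2k}`.  The tangent vector `(Y, W)` at `p` is the sum
of the lift `(Y, liftFibre p Y)` and of the vertical vector `(0, W - liftFibre p Y)`; the two kinds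
of vectors are orthogonal, `Y ↦ (Y, liftFibre p Y)` is isometric, and vertical vectors carry the
Euclidean inner product (see the three lemmas that follow). -/
def bundleMetric {m k : ℕ} (br : BilinBracket m k) (φ : ℝ → ℝ → ℝ) (p v w : TotalSpc m k) : ℝ :=
  inner ℝ v.1 w.1 + inner ℝ (v.2 - liftFibre br φ p v.1) (w.2 - liftFibre br φ p w.1)

theorem fundField_apply {k : ℕ} (Z : TorusLie k) (u : FibreSpc k) (j : Fin k) :
    fundField Z u j = (Z j : ℂ) * Complex.I * u j := by
  have h : HasDerivAt (fun t : ℝ => torusExp (t • Z) u)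
      (WithLp.toLp 2 (fun j => (Z j : ℂ) * Complex.I * u j)) 0 := by
    suffices h' : HasDerivAt (fun t : ℝ => fun j => torusExp (t • Z) u j)
        (fun j => (Z j : ℂ) * Complex.I * u j) 0 from
      ((PiLp.continuousLinearEquiv 2 ℝ (fun _ : Fin k => ℂ)).symm.hasFDerivAt.comp_hasDerivAt
        (0 : ℝ) h' :)
    rw [hasDerivAt_pi]
    intro i
    have h1 : HasDerivAt (fun t : ℝ => ((t * Z i : ℝ) : ℂ) * Complex.I)
        ((Z i : ℂ) * Complex.I) 0 := by
      have h0 : HasDerivAt (fun t : ℝ => t * Z i) (Z i) 0 := by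
        simpa using (hasDerivAt_id (0 : ℝ)).mul_const (Z i)
      exact h0.ofReal_comp.mul_const _
    have h2 := h1.cexp.mul_const (u i)
    have h3 : (fun t : ℝ => torusExp (t • Z) u i)
        = fun t : ℝ => Complex.exp (((t * Z i : ℝ) : ℂ) * Complex.I) * u i := by
      funext t
      simp [torusExp, torusRep, rotation_apply, Circle.coe_exp]
    rw [h3]
    simpa using h2
  rw [fundField, h.deriv]

theorem fundField_zero {k : ℕ} (u : FibreSpc k) : fundField 0 u = 0 := by
  ext j
  simp [fundField_apply]

theorem bundleMetric_vertical {m k : ℕ} (br : BilinBracket m k) (φ : ℝ → ℝ → ℝ) (p : TotalSpc m k)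
    (W V : FibreSpc k) : bundleMetric br φ p (0, W) (0, V) = inner ℝ W V := by
  simp [bundleMetric, liftFibre, fundField_zero]

/-- The orthogonal complement of the vertical space consists of the lifts. -/
theorem bundleMetric_horizontal_iff {m k : ℕ} (br : BilinBracket m k) (φ : ℝ → ℝ → ℝ)
    (p v : TotalSpc m k) :
    (∀ W : FibreSpc k, bundleMetric br φ p v (0, W) = 0) ↔ v = (v.1, liftFibre br φ p v.1) := by
  have h0 : liftFibre br φ p 0 = 0 := by simp [liftFibre, fundField_zero]
  constructor
  · intro h
    have h1 := h (v.2 - liftFibre br φ p v.1)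
    simp only [bundleMetric, h0, inner_zero_right, sub_zero, zero_add, inner_self_eq_zero] at h1
    exact Prod.ext rfl (sub_eq_zero.mp h1)
  · intro h W
    have h1 : v.2 = liftFibre br φ p v.1 := congrArg Prod.snd h
    simp [bundleMetric, h0, ← h1]

theorem bundleMetric_lift {m k : ℕ} (br : BilinBracket m k) (φ : ℝ → ℝ → ℝ) (p : TotalSpc m k)
    (Y Y' : BaseSpc m) :
    bundleMetric br φ p (Y, liftFibre br φ p Y) (Y', liftFibre br φ p Y') = inner ℝ Y Y' := by
  simp [bundleMetric]

/-- `τ` is an isometry from `(ℝ^{m+2k}, g)` to `(ℝ^{m+2k}, g')`: a smooth diffeomorphism whose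
differential preserves the inner products on tangent spaces. -/
structure IsRiemannianIsometry {m k : ℕ} (g g' : TotalSpc m k → TotalSpc m k → TotalSpc m k → ℝ)
    (τ : TotalSpc m k → TotalSpc m k) : Prop where
  smooth : ContDiff ℝ ∞ τ
  smooth_inverse : ∃ σ : TotalSpc m k → TotalSpc m k, ContDiff ℝ ∞ σ ∧
    Function.LeftInverse σ τ ∧ Function.RightInverse σ τ
  preserves : ∀ p v w, g' (τ p) (fderiv ℝ τ p v) (fderiv ℝ τ p w) = g p v w

/-- The lattice `(2πℤ)^k` in `ℝ^k`. -/
def torusLattice (k : ℕ) : Set (TorusLie k) :=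
  {Z | ∀ j, ∃ n : ℤ, Z j = 2 * Real.pi * n}

/-- The pair `(A, C) ∈ O(m) × O(k)` is an equivalence of `br` and `br'`: `C` preserves the lattice
`(2πℤ)^k` and `⟨[Ax, Ay]', Z⟩ = ⟨[x, y], C Z⟩`. -/
structure IsBracketEquivalence {m k : ℕ} (br br' : BilinBracket m k)
    (A : BaseSpc m ≃ₗᵢ[ℝ] BaseSpc m) (C : TorusLie k ≃ₗᵢ[ℝ] TorusLie k) : Prop where
  lattice : C '' torusLattice k = torusLattice k
  bracket : ∀ (x y : BaseSpc m) (Z : TorusLie k),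
    inner ℝ (br' (A x) (A y)) Z = inner ℝ (br x y) (C Z)

/-- The linear map `C` of `𝔷` is `Z ↦ D Z D⁻¹`, the differential of the conjugation
`z ↦ D z D⁻¹` of `T` by `D ∈ O(2k)`. As `C` is linear, this is expressed by
`D exp(Z) D⁻¹ = exp(C Z)` for all `Z`, which determines `C`. -/
def IsConjugationOnLie {k : ℕ} (D : FibreSpc k ≃ₗᵢ[ℝ] FibreSpc k)
    (C : TorusLie k ≃ₗᵢ[ℝ] TorusLie k) : Prop :=
  ∀ Z : TorusLie k, D * torusExp Z * D⁻¹ = torusExp (C Z)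

end

open scoped ContDiff

/-! The converse is direct: conjugation by $\tilde C$ intertwines the fundamental fields, so the
product map carries lifts to lifts.

For the forward direction, an orbit-preserving $\tau$ preserves the zero section, because $-1\in T$
moves every other point. Rays $t\mapsto(x,tu)$ are vertical with speed $\|u\|$, and the fibre part
of a lift is tangent to the spheres in $\mathbf R^{2k}$. Hence $\|\tau(x,u)_2\|\le\|u\|$, with
equality by applying this to $\tau^{-1}$ (`norm_snd`). Equality in the estimate forces rays to go to
vertical rays, so $\tau$ is linear on each fibre and covers an isometry $x\mapsto Ax+b$ of the base.
Lifts go to lifts (`fderiv_lift`). For large $\|u\|$ the cutoff vanishes, so the fibre map cannot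
vary with $x$ there, and by homogeneity nowhere. Thus $\tau(x,u)=(Ax+b,Du)$ (`exists_product`).

The orthogonal map $D$ permutes the coordinate planes (`exists_single_of_map_orbits`), so it acts on
$\mathfrak z$ by a signed permutation $C$, which is orthogonal and preserves the lattice. Comparing
lifts at a point $u$ with no zero coordinate relates $[Ax+b,AY]'$ to $C[x,Y]$, each weighted by the
cutoff. Compactness of the support gives $b=0$, and then the brackets agree
(`eq_of_radial_cutoff_translate`). -/

/-! ### The torus action, conjugation and the converse direction -/

theorem torusRep_apply {k : ℕ} (c : Fin k → Circle) (u : FibreSpc k) (j : Fin k) :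
    torusRep k c u j = (c j : ℂ) * u j := by
  simp [torusRep, rotation_apply]

theorem torusExp_apply {k : ℕ} (Z : TorusLie k) (u : FibreSpc k) (j : Fin k) :
    torusExp Z u j = (Circle.exp (Z j) : ℂ) * u j :=
  torusRep_apply _ u j

theorem mem_torus_iff {k : ℕ} {z : FibreSpc k ≃ₗᵢ[ℝ] FibreSpc k} :
    z ∈ torus k ↔ ∃ Z : TorusLie k, torusExp Z = z := by
  constructor
  · rintro ⟨c, rfl⟩
    refine ⟨WithLp.toLp 2 fun j => Complex.arg (c j), ?_⟩
    simp [torusExp, Circle.exp_arg]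
  · rintro ⟨Z, rfl⟩
    exact ⟨_, rfl⟩

/-- The torus acts by isometries, so its orbits lie in spheres. This is why lifts do not change the
distance to the zero section. -/
theorem inner_fundField_self {k : ℕ} (Z : TorusLie k) (u : FibreSpc k) :
    inner ℝ u (fundField Z u) = 0 := by
  rw [PiLp.inner_apply]
  refine Finset.sum_eq_zero fun j _ => ?_
  rw [fundField_apply, Complex.inner]
  simp
  ring

theorem fundField_smul_left {k : ℕ} (c : ℝ) (Z : TorusLie k) (u : FibreSpc k) :
    fundField (c • Z) u = c • fundField Z u := by
  ext j
  simp only [fundField_apply, PiLp.smul_apply, Complex.real_smul, smul_eq_mul, Complex.ofReal_mul]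
  ring

theorem fundField_injective {k : ℕ} {u : FibreSpc k} (hu : ∀ j, u j ≠ 0) :
    Function.Injective fun Z : TorusLie k => fundField Z u := by
  intro Z W h
  ext j
  have h1 := congrArg (fun v : FibreSpc k => v j) h
  simpa [fundField_apply, hu j] using h1

namespace IsConjugationOnLie

variable {k : ℕ} {D : FibreSpc k ≃ₗᵢ[ℝ] FibreSpc k} {C : TorusLie k ≃ₗᵢ[ℝ] TorusLie k}

theorem apply_torusExp (h : IsConjugationOnLie D C) (Z : TorusLie k) (u : FibreSpc k) :
    D (torusExp Z u) = torusExp (C Z) (D u) := by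
  have h1 : D * torusExp Z = torusExp (C Z) * D := by
    rw [← h Z]
    group
  exact congrArg (fun e : FibreSpc k ≃ₗᵢ[ℝ] FibreSpc k => e u) h1

theorem apply_fundField (h : IsConjugationOnLie D C) (Z : TorusLie k) (u : FibreSpc k) :
    D (fundField Z u) = fundField (C Z) (D u) := by
  have h1 : (fun t : ℝ => torusExp (t • C Z) (D u))
      = D.toContinuousLinearEquiv ∘ fun t : ℝ => torusExp (t • Z) u := by
    funext t
    simp [h.apply_torusExp]
  rw [fundField, fundField, h1, ← fderiv_apply_one_eq_deriv, ← fderiv_apply_one_eq_deriv,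
    ContinuousLinearEquiv.comp_fderiv]
  rfl

theorem mem_normalizer (h : IsConjugationOnLie D C) :
    D ∈ Subgroup.normalizer (torus k : Set (FibreSpc k ≃ₗᵢ[ℝ] FibreSpc k)) := by
  rw [Subgroup.mem_normalizer_iff]
  intro z
  rw [mem_torus_iff, mem_torus_iff]
  constructor
  · rintro ⟨Z, rfl⟩
    exact ⟨C Z, (h Z).symm⟩
  · rintro ⟨Z, hZ⟩
    refine ⟨C.symm Z, ?_⟩
    have h1 := h (C.symm Z)
    rw [C.apply_symm_apply, hZ] at h1
    exact mul_left_cancel (mul_right_cancel h1)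

end IsConjugationOnLie

theorem IsBracketEquivalence.apply_eq {m k : ℕ} {br br' : BilinBracket m k}
    {A : BaseSpc m ≃ₗᵢ[ℝ] BaseSpc m} {C : TorusLie k ≃ₗᵢ[ℝ] TorusLie k}
    (h : IsBracketEquivalence br br' A C.symm) (x y : BaseSpc m) :
    br' (A x) (A y) = C (br x y) := by
  refine ext_inner_right ℝ fun Z => ?_
  rw [h.bracket, ← C.inner_map_map (br x y), C.apply_symm_apply]

/-- Bundle maps induced by an equivalence of brackets are isometries. -/
theorem IsBracketEquivalence.isRiemannianIsometry {m k : ℕ} {br br' : BilinBracket m k}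
    {A : BaseSpc m ≃ₗᵢ[ℝ] BaseSpc m} {C : TorusLie k ≃ₗᵢ[ℝ] TorusLie k}
    (h : IsBracketEquivalence br br' A C.symm) {D : FibreSpc k ≃ₗᵢ[ℝ] FibreSpc k}
    (hD : IsConjugationOnLie D C) (φ : ℝ → ℝ → ℝ) :
    IsRiemannianIsometry (bundleMetric br φ) (bundleMetric br' φ)
      (fun p => (A p.1, D p.2)) := by
  let L : TotalSpc m k ≃L[ℝ] TotalSpc m k :=
    A.toContinuousLinearEquiv.prodCongr D.toContinuousLinearEquiv
  have hL : (fun p : TotalSpc m k => ((A p.1, D p.2) : TotalSpc m k)) = L := rfl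
  refine ⟨hL ▸ L.contDiff, ⟨L.symm, L.symm.contDiff, ?_, ?_⟩, ?_⟩
  · exact fun p => L.symm_apply_apply p
  · exact fun p => L.apply_symm_apply p
  · intro p v w
    have hlift (v : BaseSpc m) : liftFibre br' φ (A p.1, D p.2) (A v)
        = D (liftFibre br φ p v) := by
      simp [liftFibre, h.apply_eq, hD.apply_fundField]
    rw [hL, L.fderiv]
    change inner ℝ (A v.1) (A w.1) + inner ℝ (D v.2 - liftFibre br' φ (A p.1, D p.2) (A v.1))
      (D w.2 - liftFibre br' φ (A p.1, D p.2) (A w.1)) = _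
    rw [hlift, hlift, ← map_sub, ← map_sub, A.inner_map_map, D.inner_map_map]
    rfl

/-! ### Orthogonal maps that carry torus orbits to torus orbits -/

/-- Three pairwise orthogonal complex numbers cannot all be nonzero. -/
theorem Complex.eq_zero_of_pairwise_orthogonal {a b c : ℂ} (hab : inner ℝ a b = 0)
    (hac : inner ℝ a c = 0) (hbc : inner ℝ b c = 0) (ha : a ≠ 0) (hb : b ≠ 0) : c = 0 := by
  rw [Complex.inner] at hab hac hbc
  simp only [Complex.mul_re, Complex.conj_re, Complex.conj_im] at hab hac hbc
  by_contra! hc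
  have h1 : 0 < a.re ^ 2 + a.im ^ 2 := by
    rw [← Complex.normSq_pos, Complex.normSq_apply] at ha
    nlinarith
  have h2 : 0 < b.re ^ 2 + b.im ^ 2 := by
    rw [← Complex.normSq_pos, Complex.normSq_apply] at hb
    nlinarith
  have h3 : 0 < c.re ^ 2 + c.im ^ 2 := by
    rw [← Complex.normSq_pos, Complex.normSq_apply] at hc
    nlinarith
  -- Both `b` and `c` are orthogonal to `a`, so their determinant vanishes; Lagrange's identity then
  -- turns $\langle b,c\rangle=0$ into $|b|^2|c|^2=0$.
  have h4 : (a.re ^ 2 + a.im ^ 2) * (b.re * c.im - b.im * c.re) = 0 := by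
    linear_combination (a.re * c.im - a.im * c.re) * hab
      + (-a.re * b.im + a.im * b.re) * hac
  have h5 : b.re * c.im - b.im * c.re = 0 := (mul_eq_zero.mp h4).resolve_left h1.ne'
  have h6 : (b.re ^ 2 + b.im ^ 2) * (c.re ^ 2 + c.im ^ 2) = 0 := by
    linear_combination (b.re * c.im - b.im * c.re) * h5 + (b.re * c.re + b.im * c.im) * hbc
  exact (mul_pos h2 h3).ne' h6

theorem inner_single_single {k : ℕ} (j : Fin k) (a b : ℂ) :
    inner ℝ (PiLp.single 2 j a : FibreSpc k) (PiLp.single 2 j b) = inner ℝ a b := by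
  rw [PiLp.inner_apply, Finset.sum_eq_single j] <;> simp +contextual

theorem inner_single_single_of_ne {k : ℕ} {i j : Fin k} (h : i ≠ j) (a b : ℂ) :
    inner ℝ (PiLp.single 2 i a : FibreSpc k) (PiLp.single 2 j b) = 0 := by
  rw [PiLp.inner_apply]
  refine Finset.sum_eq_zero fun l _ => ?_
  rcases eq_or_ne l i with rfl | hl
  · simp [h]
  · simp [PiLp.single_apply, hl]

theorem fibre_single_zero {k : ℕ} (j : Fin k) : (PiLp.single 2 j 0 : FibreSpc k) = 0 :=
  (PiLp.single_eq_zero_iff 2 j).mpr rfl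

theorem inner_one_I : inner ℝ (1 : ℂ) Complex.I = 0 := by
  simp [Complex.inner]

/-- An orbit-preserving orthogonal map sends each coordinate plane into a coordinate plane. -/
theorem exists_single_of_map_orbits {k : ℕ} (D : FibreSpc k ≃ₗᵢ[ℝ] FibreSpc k)
    (h : ∀ u, ∀ z ∈ torus k, ∃ z' ∈ torus k, D (z u) = z' (D u))
    (h' : ∀ u, ∀ z ∈ torus k, ∃ z' ∈ torus k, z (D u) = D (z' u)) (j : Fin k) :
    ∃ l, ∀ w : ℂ, D (PiLp.single 2 j w) = PiLp.single 2 l (D (PiLp.single 2 j w) l) := by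
  set q : FibreSpc k := D (PiLp.single 2 j 1) with hq
  have hq0 : q ≠ 0 := by
    rw [hq]
    simp
  -- Rotating `q` in the `l`-th plane alone stays in the image of the `j`-th plane; subtracting `q`
  -- isolates the `l`-th coordinate.
  have key (l : Fin k) (c : Circle) :
      ∃ a : ℂ, D (PiLp.single 2 j a) = PiLp.single 2 l (((c : ℂ) - 1) * q l) := by
    obtain ⟨z', ⟨d, rfl⟩, hz'⟩ := h' (PiLp.single 2 j 1)
      (torusRep k (Function.update 1 l c)) ⟨_, rfl⟩
    refine ⟨(d j : ℂ) - 1, ?_⟩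
    have h1 : torusRep k d (PiLp.single 2 j 1) = PiLp.single 2 j (d j : ℂ) := by
      ext i
      rw [torusRep_apply]
      rcases eq_or_ne i j with rfl | hi <;> simp [*]
    rw [h1, ← hq] at hz'
    rw [PiLp.single_sub, map_sub, ← hz', ← hq]
    ext i
    rw [PiLp.sub_apply, torusRep_apply]
    rcases eq_or_ne i l with rfl | hi
    · simp [sub_mul]
    · simp [hi]
  obtain ⟨l, hl⟩ : ∃ l, q l ≠ 0 := by
    by_contra! hall
    exact hq0 (by ext i; simp [hall i])
  -- The rotations by $\pm i$ give orthogonal nonzero vectors in plane `l`, and $-1$ gives $-2q_i$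
  -- in plane `i`. All come from the single plane `j`, which has no room for a third direction.
  have huniq (i : Fin k) (hi : i ≠ l) : q i = 0 := by
    let c : Circle := Circle.exp (Real.pi / 2)
    have hc : (c : ℂ) = Complex.I := by
      simp [c, Circle.coe_exp]
    let e : Circle := Circle.exp Real.pi
    have he : (e : ℂ) = -1 := by
      simp [e, Circle.coe_exp]
    let e' : Circle := Circle.exp (-(Real.pi / 2))
    have he' : (e' : ℂ) = -Complex.I := by
      simp [e', Circle.coe_exp]
    obtain ⟨a, ha⟩ := key l c
    obtain ⟨b, hb⟩ := key l e'
    obtain ⟨d, hd⟩ := key i e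
    rw [hc] at ha
    rw [he'] at hb
    rw [he] at hd
    have hab : inner ℝ a b = 0 := by
      rw [← inner_single_single j, ← D.inner_map_map, ha, hb, inner_single_single, Complex.inner]
      simp
      ring
    have had : inner ℝ a d = 0 := by
      rw [← inner_single_single j, ← D.inner_map_map, ha, hd, inner_single_single_of_ne hi.symm]
    have hbd : inner ℝ b d = 0 := by
      rw [← inner_single_single j, ← D.inner_map_map, hb, hd, inner_single_single_of_ne hi.symm]
    have hI1 : Complex.I - 1 ≠ 0 := fun h0 => by simpa using congrArg Complex.re h0
    have hI2 : -Complex.I - 1 ≠ 0 := fun h0 => by simpa using congrArg Complex.re h0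
    have ha0 : a ≠ 0 := by
      rintro rfl
      rw [fibre_single_zero, map_zero, eq_comm, PiLp.single_eq_zero_iff] at ha
      exact mul_ne_zero hI1 hl ha
    have hb0 : b ≠ 0 := by
      rintro rfl
      rw [fibre_single_zero, map_zero, eq_comm, PiLp.single_eq_zero_iff] at hb
      exact mul_ne_zero hI2 hl hb
    have hd0 := Complex.eq_zero_of_pairwise_orthogonal hab had hbd ha0 hb0
    rw [hd0, fibre_single_zero, map_zero, eq_comm, PiLp.single_eq_zero_iff] at hd
    exact (mul_eq_zero.mp hd).resolve_left (by norm_num)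
  have hcirc (c : Circle) (i : Fin k) (hi : i ≠ l) : D (PiLp.single 2 j (c : ℂ)) i = 0 := by
    obtain ⟨z', ⟨d, rfl⟩, hz'⟩ := h (PiLp.single 2 j 1) (torusRep k fun _ => c) ⟨_, rfl⟩
    have h1 : torusRep k (fun _ => c) (PiLp.single 2 j 1) = PiLp.single 2 j (c : ℂ) := by
      ext i
      rw [torusRep_apply]
      rcases eq_or_ne i j with rfl | hi <;> simp [*]
    rw [h1, ← hq] at hz'
    rw [hz', torusRep_apply, huniq i hi, mul_zero]
  refine ⟨l, fun w => ?_⟩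
  have hw : (PiLp.single 2 j w : FibreSpc k)
      = ‖w‖ • PiLp.single 2 j (Circle.exp (Complex.arg w) : ℂ) := by
    ext i
    rcases eq_or_ne i j with rfl | hi
    · simp [Circle.coe_exp]
    · simp [hi]
  ext i
  rcases eq_or_ne i l with rfl | hi
  · simp
  · rw [hw, map_smul, PiLp.smul_apply, hcirc _ i hi]
    simp [hi]

/-- A real isometry of `ℂ` conjugates rotations to rotations. -/
theorem exists_sign_of_isometry_complex (f : ℂ →ₗᵢ[ℝ] ℂ) :
    ∃ e : ℝ, (e = 1 ∨ e = -1) ∧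
      ∀ (θ : ℝ) (w : ℂ), f (Circle.exp θ * w) = Circle.exp (e * θ) * f w := by
  obtain ⟨a, ha⟩ := linear_isometry_complex (f.toLinearIsometryEquiv rfl)
  have hf (w : ℂ) : f w = f.toLinearIsometryEquiv rfl w := rfl
  rcases ha with ha | ha
  · refine ⟨1, Or.inl rfl, fun θ w => ?_⟩
    simp only [hf, ha, rotation_apply, one_mul]
    ring
  · refine ⟨-1, Or.inr rfl, fun θ w => ?_⟩
    simp only [hf, ha, LinearIsometryEquiv.trans_apply, rotation_apply, Complex.conjLIE_apply,
      map_mul, neg_one_mul, Circle.exp_neg, Circle.coe_inv_eq_conj]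
    ring

/-- An orthogonal map carrying torus orbits to torus orbits normalizes the torus, and acts on its
Lie algebra by a signed permutation of the coordinates. -/
theorem exists_isConjugationOnLie {k : ℕ} (D : FibreSpc k ≃ₗᵢ[ℝ] FibreSpc k)
    (h : ∀ u, ∀ z ∈ torus k, ∃ z' ∈ torus k, D (z u) = z' (D u))
    (h' : ∀ u, ∀ z ∈ torus k, ∃ z' ∈ torus k, z (D u) = D (z' u)) :
    ∃ C : TorusLie k ≃ₗᵢ[ℝ] TorusLie k,
      IsConjugationOnLie D C ∧ C '' torusLattice k = torusLattice k := by
  choose σ hσ using exists_single_of_map_orbits D h h'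
  have hnz (j : Fin k) {w : ℂ} (hw : w ≠ 0) : D (PiLp.single 2 j w) (σ j) ≠ 0 := fun h0 => by
    have h1 := hσ j w
    rw [h0, fibre_single_zero, map_eq_zero_iff D D.injective, PiLp.single_eq_zero_iff] at h1
    exact hw h1
  have hinj : Function.Injective σ := by
    intro i j hij
    by_contra hne
    -- If planes `i` and `j` had the same target, the images of $1$ and $\mathrm i$ from plane `i`
    -- and of $1$ from plane `j` would be three orthogonal nonzero vectors in it.
    refine hnz j (one_ne_zero) (Complex.eq_zero_of_pairwise_orthogonal ?_ ?_ ?_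
      (hnz i one_ne_zero) (hnz i Complex.I_ne_zero))
    · rw [← inner_single_single (σ i), ← hσ, ← hσ, D.inner_map_map, inner_single_single,
        inner_one_I]
    · rw [← inner_single_single (σ i), ← hσ, hij, ← hσ, D.inner_map_map,
        inner_single_single_of_ne hne]
    · rw [← inner_single_single (σ i), ← hσ, hij, ← hσ, D.inner_map_map,
        inner_single_single_of_ne hne]
  let s : Fin k ≃ Fin k := Equiv.ofBijective σ (Finite.injective_iff_bijective.mp hinj)
  let f (j : Fin k) : ℂ →ₗᵢ[ℝ] ℂ :=
    { toFun := fun w => D (PiLp.single 2 j w) (σ j)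
      map_add' := fun a b => by rw [PiLp.single_add, map_add, PiLp.add_apply]
      map_smul' := fun c a => by
        have h1 : (PiLp.single 2 j (c • a) : FibreSpc k) = c • PiLp.single 2 j a := by
          ext i
          rcases eq_or_ne i j with rfl | hi <;> simp [*]
        rw [h1, map_smul, PiLp.smul_apply, RingHom.id_apply]
      norm_map' := fun a => by
        change ‖D (PiLp.single 2 j a) (σ j)‖ = ‖a‖
        rw [← PiLp.norm_single 2 (fun _ : Fin k => ℂ) (σ j), ← hσ, D.norm_map, PiLp.norm_single] }
  have hf (u : FibreSpc k) (j : Fin k) : D u (σ j) = f j (u j) := by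
    have hu : u = ∑ i, PiLp.single 2 i (u i) := by
      ext l
      rw [WithLp.ofLp_sum, Finset.sum_apply, Finset.sum_eq_single l] <;>
        simp +contextual [eq_comm]
    conv_lhs => rw [hu]
    rw [map_sum, WithLp.ofLp_sum, Finset.sum_apply, Finset.sum_eq_single j]
    · rfl
    · intro i _ hi
      rw [hσ, PiLp.single_apply, if_neg fun h0 => hi (hinj h0).symm]
    · simp
  choose e he hfe using fun j => exists_sign_of_isometry_complex (f j)
  let C : TorusLie k ≃ₗᵢ[ℝ] TorusLie k :=
    (LinearIsometryEquiv.piLpCongrRight 2 fun j =>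
      if e j = 1 then LinearIsometryEquiv.refl ℝ ℝ else LinearIsometryEquiv.neg ℝ).trans
    (LinearIsometryEquiv.piLpCongrLeft 2 ℝ ℝ s)
  have hC (Z : TorusLie k) (j : Fin k) : C Z (σ j) = e j * Z j := by
    have h1 : C Z (s j) = (if e j = 1 then LinearIsometryEquiv.refl ℝ ℝ
        else LinearIsometryEquiv.neg ℝ) (Z j) := by
      simp [C, Equiv.piCongrLeft'_apply]
    change C Z (s j) = _
    rw [h1]
    rcases he j with hj | hj
    · simp [hj]
    · norm_num [hj]
  have hsurj (l : Fin k) : ∃ j, σ j = l := s.surjective l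
  refine ⟨C, fun Z => ?_, ?_⟩
  · rw [mul_inv_eq_iff_eq_mul]
    ext u l
    obtain ⟨j, rfl⟩ := hsurj l
    change D (torusExp Z u) (σ j) = torusExp (C Z) (D u) (σ j)
    rw [torusExp_apply, hf, hf, torusExp_apply, hfe, hC]
  · have hmem (Z : TorusLie k) : C Z ∈ torusLattice k ↔ Z ∈ torusLattice k := by
      have hneg (r : ℝ) : (∃ n : ℤ, -r = 2 * Real.pi * n) ↔ ∃ n : ℤ, r = 2 * Real.pi * n := by
        constructor <;> rintro ⟨n, hn⟩ <;> refine ⟨-n, ?_⟩ <;> push_cast <;> linarith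
      have hj (j : Fin k) : (∃ n : ℤ, C Z (σ j) = 2 * Real.pi * n)
          ↔ ∃ n : ℤ, Z j = 2 * Real.pi * n := by
        rw [hC]
        rcases he j with hj | hj
        · simp [hj]
        · simp only [hj, neg_one_mul, hneg]
      constructor
      · intro hZ j
        exact (hj j).mp (hZ (σ j))
      · intro hZ l
        obtain ⟨j, rfl⟩ := hsurj l
        exact (hj j).mpr (hZ j)
    ext W
    constructor
    · rintro ⟨Z, hZ, rfl⟩
      exact (hmem Z).mpr hZ
    · intro hW
      exact ⟨C.symm W, (hmem _).mp (by simpa using hW), by simp⟩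

/-! ### The cutoff function, lifts and orbits -/

theorem IsCutoff.exists_bound {φ : ℝ → ℝ → ℝ} (hφ : IsCutoff φ) :
    ∃ M : ℝ, 0 ≤ M ∧ ∀ s t : ℝ, 0 ≤ s → 0 ≤ t → (M < s ∨ M < t) → φ s t = 0 := by
  obtain ⟨K, hK, hφK⟩ := hφ.compact_support
  obtain ⟨M, hM⟩ := hK.isBounded.exists_norm_le
  refine ⟨max M 0, le_max_right _ _, fun s t hs ht hst => hφK s t hs ht fun hmem => ?_⟩
  have h1 := hM _ hmem
  rw [Prod.norm_mk, Real.norm_of_nonneg hs, Real.norm_of_nonneg ht] at h1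
  have h2 := le_max_left M 0
  have h3 := le_max_left s t
  have h4 := le_max_right s t
  rcases hst with h | h <;> linarith

/-- A nonzero value persists under a small diagonal shift into the open quadrant, by continuity.
Positive `t` leaves room for a fibre point with all coordinates nonzero. -/
theorem IsCutoff.exists_pos_ne_zero {φ : ℝ → ℝ → ℝ} (hφ : IsCutoff φ)
    (hφ0 : ∃ s t : ℝ, 0 ≤ s ∧ 0 ≤ t ∧ φ s t ≠ 0) : ∃ s t : ℝ, 0 < s ∧ 0 < t ∧ φ s t ≠ 0 := by
  obtain ⟨s, t, hs, ht, hst⟩ := hφ0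
  have h1 : ContinuousOn (fun c : ℝ => φ (s + c) (t + c)) (Set.Ici 0) := by
    refine hφ.smooth.continuousOn.comp (f := fun c : ℝ => (s + c, t + c)) (by fun_prop) ?_
    intro c hc
    exact ⟨add_nonneg hs hc, add_nonneg ht hc⟩
  have h2 : ∀ᶠ c in nhdsWithin (0 : ℝ) (Set.Ioi 0), φ (s + c) (t + c) ≠ 0 := by
    have h3 := (h1 0 Set.self_mem_Ici).mono Set.Ioi_subset_Ici_self
    exact h3.eventually_ne (by simpa using hst)
  obtain ⟨c, hc, hc0⟩ := (h2.and self_mem_nhdsWithin).exists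
  have hc0 : 0 < c := hc0
  exact ⟨s + c, t + c, by linarith, by linarith, hc⟩

section Lift

variable {m k : ℕ} (br : BilinBracket m k) (φ : ℝ → ℝ → ℝ)

theorem liftFibre_zero (p : TotalSpc m k) : liftFibre br φ p 0 = 0 := by
  simp [liftFibre, fundField_zero]

theorem liftFibre_of_snd_eq_zero {p : TotalSpc m k} (hp : p.2 = 0) (Y : BaseSpc m) :
    liftFibre br φ p Y = 0 := by
  have h : fundField (br p.1 Y) p.2 = 0 := by
    ext j
    simp [fundField_apply, hp]
  rw [liftFibre, h, smul_zero]

theorem inner_liftFibre (p : TotalSpc m k) (Y : BaseSpc m) :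
    inner ℝ p.2 (liftFibre br φ p Y) = 0 := by
  rw [liftFibre, inner_smul_right, inner_fundField_self, mul_zero]

theorem bundleMetric_self (p v : TotalSpc m k) :
    bundleMetric br φ p v v = ‖v.1‖ ^ 2 + ‖v.2 - liftFibre br φ p v.1‖ ^ 2 := by
  rw [bundleMetric, real_inner_self_eq_norm_sq, real_inner_self_eq_norm_sq]

end Lift

section Orbits

variable {m k : ℕ} {τ σ : TotalSpc m k → TotalSpc m k}

theorem self_mem_torusOrbit (p : TotalSpc m k) : p ∈ torusOrbit p :=
  ⟨1, one_mem _, rfl⟩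

theorem torusOrbit_eq_of_mem {p q : TotalSpc m k} (h : q ∈ torusOrbit p) :
    torusOrbit q = torusOrbit p := by
  obtain ⟨z, hz, rfl⟩ := h
  ext r
  constructor
  · rintro ⟨w, hw, rfl⟩
    exact ⟨w * z, mul_mem hw hz, rfl⟩
  · rintro ⟨w, hw, rfl⟩
    refine ⟨w * z⁻¹, mul_mem hw (inv_mem hz), ?_⟩
    simp [LinearIsometryEquiv.inv_def]

theorem CarriesOrbits.image_torusOrbit (hc : CarriesOrbits τ) (p : TotalSpc m k) :
    τ '' torusOrbit p = torusOrbit (τ p) := by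
  obtain ⟨q, hq⟩ := hc p
  exact hq.trans (torusOrbit_eq_of_mem
    (hq ▸ Set.mem_image_of_mem τ (self_mem_torusOrbit p))).symm

theorem CarriesOrbits.inverse (hc : CarriesOrbits τ) (h1 : Function.LeftInverse σ τ)
    (h2 : Function.RightInverse σ τ) : CarriesOrbits σ := by
  intro q
  refine ⟨σ q, ?_⟩
  have h3 := hc.image_torusOrbit (σ q)
  rw [h2 q] at h3
  rw [← h3, ← Set.image_comp, h1.comp_eq_id, Set.image_id]

theorem CarriesOrbits.snd_eq_zero (hc : CarriesOrbits τ) (x : BaseSpc m) :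
    (τ (x, 0)).2 = 0 := by
  have h1 := hc.image_torusOrbit (x, 0)
  -- The orbit of $(x,0)$ is one point, hence so is its image; the element $-1\in T$ then fixes the
  -- image.
  have h2 : ((τ (x, 0)).1, -(τ (x, 0)).2) ∈ torusOrbit (τ (x, 0)) := by
    refine ⟨torusRep k fun _ => Circle.exp Real.pi, ⟨_, rfl⟩, Prod.ext rfl ?_⟩
    ext j
    simp [torusRep_apply, Circle.coe_exp]
  rw [← h1] at h2
  obtain ⟨q, ⟨z, hz, rfl⟩, hq⟩ := h2
  rw [map_zero] at hq
  have h3 : (τ (x, 0)).2 + (τ (x, 0)).2 = 0 := add_eq_zero_iff_eq_neg.mpr (congrArg Prod.snd hq)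
  rw [← two_smul ℝ] at h3
  exact (smul_eq_zero.mp h3).resolve_left two_ne_zero

end Orbits

/-! ### Rigidity of orbit-preserving isometries -/

namespace IsRiemannianIsometry

variable {m k : ℕ} {br br' : BilinBracket m k} {φ : ℝ → ℝ → ℝ} {τ σ : TotalSpc m k → TotalSpc m k}

theorem differentiable {g g' : TotalSpc m k → TotalSpc m k → TotalSpc m k → ℝ}
    (hτ : IsRiemannianIsometry g g' τ) : Differentiable ℝ τ :=
  hτ.smooth.differentiable (by simp)

theorem inverse {g g' : TotalSpc m k → TotalSpc m k → TotalSpc m k → ℝ}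
    (hτ : IsRiemannianIsometry g g' τ) (hσ : ContDiff ℝ ∞ σ) (h1 : Function.LeftInverse σ τ)
    (h2 : Function.RightInverse σ τ) : IsRiemannianIsometry g' g σ := by
  refine ⟨hσ, ⟨τ, hτ.smooth, h2, h1⟩, fun q v w => ?_⟩
  have h3 (v : TotalSpc m k) : fderiv ℝ τ (σ q) (fderiv ℝ σ q v) = v := by
    have h4 := ((hτ.differentiable (σ q)).hasFDerivAt.comp q
      (hσ.differentiable (by simp) q).hasFDerivAt).fderiv
    rw [h2.comp_eq_id, fderiv_id] at h4
    exact (congrArg (fun e : TotalSpc m k →L[ℝ] TotalSpc m k => e v) h4).symm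
  rw [← hτ.preserves, h2 q, h3, h3]

theorem hasDerivAt_radial {g g' : TotalSpc m k → TotalSpc m k → TotalSpc m k → ℝ}
    (hτ : IsRiemannianIsometry g g' τ) (x : BaseSpc m) (u : FibreSpc k) (t : ℝ) :
    HasDerivAt (fun t : ℝ => τ (x, t • u)) (fderiv ℝ τ (x, t • u) (0, u)) t := by
  have h1 : HasDerivAt (fun t : ℝ => ((x, t • u) : TotalSpc m k)) (0, u) t := by
    refine (hasDerivAt_const t x).prodMk ?_
    simpa using (hasDerivAt_id t).smul_const u
  exact (hτ.differentiable (x, t • u)).hasFDerivAt.comp_hasDerivAt t h1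

theorem hasDerivAt_radial_fst {g g' : TotalSpc m k → TotalSpc m k → TotalSpc m k → ℝ}
    (hτ : IsRiemannianIsometry g g' τ) (x : BaseSpc m) (u : FibreSpc k) (t : ℝ) :
    HasDerivAt (fun t : ℝ => (τ (x, t • u)).1) (fderiv ℝ τ (x, t • u) (0, u)).1 t :=
  (ContinuousLinearMap.fst ℝ (BaseSpc m) (FibreSpc k)).hasFDerivAt.comp_hasDerivAt t
    (hτ.hasDerivAt_radial x u t)

theorem hasDerivAt_radial_snd {g g' : TotalSpc m k → TotalSpc m k → TotalSpc m k → ℝ}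
    (hτ : IsRiemannianIsometry g g' τ) (x : BaseSpc m) (u : FibreSpc k) (t : ℝ) :
    HasDerivAt (fun t : ℝ => (τ (x, t • u)).2) (fderiv ℝ τ (x, t • u) (0, u)).2 t :=
  (ContinuousLinearMap.snd ℝ (BaseSpc m) (FibreSpc k)).hasFDerivAt.comp_hasDerivAt t
    (hτ.hasDerivAt_radial x u t)

variable (hτ : IsRiemannianIsometry (bundleMetric br φ) (bundleMetric br' φ) τ)

include hτ

theorem norm_sq_radial (x : BaseSpc m) (u : FibreSpc k) (t : ℝ) :
    ‖(fderiv ℝ τ (x, t • u) (0, u)).1‖ ^ 2 + ‖(fderiv ℝ τ (x, t • u) (0, u)).2 -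
      liftFibre br' φ (τ (x, t • u)) (fderiv ℝ τ (x, t • u) (0, u)).1‖ ^ 2 = ‖u‖ ^ 2 := by
  rw [← bundleMetric_self, hτ.preserves, bundleMetric_vertical, real_inner_self_eq_norm_sq]

theorem hasDerivAt_norm_sq_radial (x : BaseSpc m) (u : FibreSpc k) (t : ℝ) :
    HasDerivAt (fun t : ℝ => ‖(τ (x, t • u)).2‖ ^ 2)
      (2 * inner ℝ (τ (x, t • u)).2 ((fderiv ℝ τ (x, t • u) (0, u)).2 -
        liftFibre br' φ (τ (x, t • u)) (fderiv ℝ τ (x, t • u) (0, u)).1)) t := by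
  rw [inner_sub_right, inner_liftFibre, sub_zero]
  exact (hτ.hasDerivAt_radial_snd x u t).norm_sq

/-- The distance to the zero section does not increase. -/
theorem norm_snd_le (hc : CarriesOrbits τ) (x : BaseSpc m) (u : FibreSpc k) :
    ‖(τ (x, u)).2‖ ≤ ‖u‖ := by
  refine le_of_forall_pos_le_add fun ε hε => ?_
  -- The term $\varepsilon^2$ keeps the root differentiable where the fibre component vanishes.
  let f : ℝ → ℝ := fun t => √(‖(τ (x, t • u)).2‖ ^ 2 + ε ^ 2)
  have hpos (t : ℝ) : 0 < ‖(τ (x, t • u)).2‖ ^ 2 + ε ^ 2 := by positivity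
  have hf (t : ℝ) := ((hτ.hasDerivAt_norm_sq_radial x u t).add_const (ε ^ 2)).sqrt (hpos t).ne'
  have h1 := image_sub_le_mul_sub_of_deriv_le (f := f) (fun t => (hf t).differentiableAt)
    (C := ‖u‖) (fun t => ?_) zero_le_one
  · have h2 : f 0 = ε := by
      simp [f, hc.snd_eq_zero, hε.le]
    have h3 : ‖(τ (x, u)).2‖ ≤ f 1 := by
      refine Real.le_sqrt_of_sq_le ?_
      rw [one_smul]
      nlinarith
    rw [h2] at h1
    linarith
  · rw [(hf t).deriv, mul_div_mul_left _ _ two_ne_zero, div_le_iff₀ (Real.sqrt_pos.mpr (hpos t))]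
    refine (real_inner_le_norm _ _).trans ?_
    rw [mul_comm]
    refine mul_le_mul ?_ ?_ (norm_nonneg _) (norm_nonneg _)
    · refine le_of_sq_le_sq ?_ (norm_nonneg _)
      have h4 := hτ.norm_sq_radial x u t
      nlinarith [sq_nonneg ‖(fderiv ℝ τ (x, t • u) (0, u)).1‖]
    · refine Real.le_sqrt_of_sq_le ?_
      nlinarith

theorem norm_snd (hc : CarriesOrbits τ) (x : BaseSpc m) (u : FibreSpc k) :
    ‖(τ (x, u)).2‖ = ‖u‖ := by
  refine le_antisymm (hτ.norm_snd_le hc x u) ?_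
  obtain ⟨σ, hσ, h1, h2⟩ := hτ.smooth_inverse
  have h3 := (hτ.inverse hσ h1 h2).norm_snd_le (hc.inverse h1 h2) (τ (x, u)).1 (τ (x, u)).2
  rwa [Prod.mk.eta, h1] at h3

/-- Radial lines are mapped to radial lines: the equality case of the distance estimate. -/
theorem fderiv_radial (hc : CarriesOrbits τ) (x : BaseSpc m) (u : FibreSpc k) {t : ℝ}
    (ht : 0 < t) : fderiv ℝ τ (x, t • u) (0, u) = (0, t⁻¹ • (τ (x, t • u)).2) := by
  have h1 := hτ.norm_sq_radial x u t
  have h2 := hτ.hasDerivAt_norm_sq_radial x u t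
  have h3 : HasDerivAt (fun t : ℝ => ‖(τ (x, t • u)).2‖ ^ 2) (2 * t * ‖u‖ ^ 2) t := by
    have h4 : (fun t : ℝ => ‖(τ (x, t • u)).2‖ ^ 2) = fun t => t ^ 2 * ‖u‖ ^ 2 := by
      funext t
      rw [hτ.norm_snd hc, norm_smul, mul_pow, Real.norm_eq_abs, sq_abs]
    rw [h4]
    simpa using (hasDerivAt_pow 2 t).mul_const (‖u‖ ^ 2)
  have h5 := h2.unique h3
  have h6 : ‖(τ (x, t • u)).2‖ ^ 2 = t ^ 2 * ‖u‖ ^ 2 := by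
    rw [hτ.norm_snd hc, norm_smul, mul_pow, Real.norm_eq_abs, sq_abs]
  set v := fderiv ℝ τ (x, t • u) (0, u)
  set w := (τ (x, t • u)).2
  set z := v.2 - liftFibre br' φ (τ (x, t • u)) v.1 with hz
  -- Expanding the square gives $\|u\|^2-2\|u\|^2+\|u\|^2$, by `h1`, the derivative `h5` and the
  -- norm `h6`.
  have h7 : ‖v.1‖ ^ 2 + ‖z - t⁻¹ • w‖ ^ 2 = 0 := by
    rw [norm_sub_sq_real, inner_smul_right, norm_smul, mul_pow, h6, real_inner_comm, norm_inv,
      inv_pow, Real.norm_eq_abs, sq_abs]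
    have h8 : inner ℝ w z = t * ‖u‖ ^ 2 := by linarith
    rw [h8]
    field_simp
    linarith
  have h8 : v.1 = 0 := by
    rw [← norm_eq_zero, ← sq_eq_zero_iff]
    nlinarith [sq_nonneg ‖v.1‖, sq_nonneg ‖z - t⁻¹ • w‖]
  have h9 : z - t⁻¹ • w = 0 := by
    rw [← norm_eq_zero, ← sq_eq_zero_iff]
    nlinarith [sq_nonneg ‖v.1‖, sq_nonneg ‖z - t⁻¹ • w‖]
  rw [hz, h8, liftFibre_zero, sub_zero, sub_eq_zero] at h9
  exact Prod.ext h8 h9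

theorem apply_smul_of_pos (hc : CarriesOrbits τ) (x : BaseSpc m) (u : FibreSpc k) {t : ℝ}
    (ht : 0 < t) : τ (x, t • u) = ((τ (x, u)).1, t • (τ (x, u)).2) := by
  let F : ℝ → TotalSpc m k := fun t => ((τ (x, t • u)).1, t⁻¹ • (τ (x, t • u)).2)
  have hF (t : ℝ) (ht : 0 < t) : HasDerivAt F 0 t := by
    have h1 := hτ.hasDerivAt_radial_fst x u t
    have h2 := hτ.hasDerivAt_radial_snd x u t
    rw [hτ.fderiv_radial hc x u ht] at h1 h2
    refine (h1.prodMk ((hasDerivAt_inv ht.ne').smul h2)).congr_deriv ?_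
    refine Prod.ext rfl ?_
    simp only [Prod.snd_zero, smul_smul, ← add_smul]
    have h3 : t⁻¹ * t⁻¹ + -(t ^ 2)⁻¹ = 0 := by
      field_simp
      ring
    rw [h3, zero_smul]
  have h1 : F t = F 1 := isOpen_Ioi.is_const_of_deriv_eq_zero isPreconnected_Ioi
    (fun s hs => (hF s hs).differentiableAt.differentiableWithinAt) (fun s hs => (hF s hs).deriv)
    ht (Set.mem_Ioi.mpr one_pos)
  simp only [F, one_smul, inv_one] at h1
  rw [Prod.mk.injEq, inv_smul_eq_iff₀ ht.ne'] at h1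
  exact Prod.ext h1.1 h1.2

theorem fst_eq (hc : CarriesOrbits τ) (x : BaseSpc m) (u : FibreSpc k) :
    (τ (x, u)).1 = (τ (x, 0)).1 := by
  have h1 : Filter.Tendsto (fun t : ℝ => (τ (x, t • u)).1) (nhdsWithin 0 (Set.Ioi 0))
      (nhds (τ (x, 0)).1) := by
    have h2 : ContinuousAt (fun t : ℝ => (τ (x, t • u)).1) 0 :=
      (hτ.hasDerivAt_radial_fst x u 0).continuousAt
    have h3 := h2.tendsto.mono_left (nhdsWithin_le_nhds (s := Set.Ioi 0))
    rwa [zero_smul] at h3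
  refine tendsto_nhds_unique (tendsto_const_nhds.congr' ?_) h1
  filter_upwards [self_mem_nhdsWithin] with t ht
  rw [hτ.apply_smul_of_pos hc x u ht]

/-- A positively homogeneous map that is differentiable at the origin equals its derivative there.
This gives linearity on the fibres. -/
theorem snd_eq_fderiv (hc : CarriesOrbits τ) (x : BaseSpc m) (u : FibreSpc k) :
    (τ (x, u)).2 = (fderiv ℝ τ (x, 0) (0, u)).2 := by
  have h1 := (hτ.hasDerivAt_radial_snd x u 0).hasDerivWithinAt (s := Set.Ici 0)
  have h2 : HasDerivWithinAt (fun t : ℝ => (τ (x, t • u)).2) (τ (x, u)).2 (Set.Ici 0) 0 := by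
    have h3 : HasDerivWithinAt (fun t : ℝ => t • (τ (x, u)).2) (τ (x, u)).2 (Set.Ici 0) 0 := by
      simpa using ((hasDerivAt_id (0 : ℝ)).smul_const (τ (x, u)).2).hasDerivWithinAt
    refine h3.congr (fun t ht => ?_) (by simp [hc.snd_eq_zero])
    rcases (Set.mem_Ici.mp ht).eq_or_lt with rfl | ht
    · simp [hc.snd_eq_zero]
    · rw [hτ.apply_smul_of_pos hc x u ht]
  rw [(uniqueDiffOn_Ici (0 : ℝ) 0 Set.self_mem_Ici).eq_deriv _ h2 h1, zero_smul]

theorem snd_smul (hc : CarriesOrbits τ) (x : BaseSpc m) (c : ℝ) (u : FibreSpc k) :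
    (τ (x, c • u)).2 = c • (τ (x, u)).2 := by
  rw [hτ.snd_eq_fderiv hc, hτ.snd_eq_fderiv hc, ← Prod.smul_snd, ← map_smul, Prod.smul_mk,
    smul_zero]

theorem hasFDerivAt_slice (x : BaseSpc m) (u : FibreSpc k) :
    HasFDerivAt (fun x => τ (x, u))
      (fderiv ℝ τ (x, u) ∘L ContinuousLinearMap.inl ℝ (BaseSpc m) (FibreSpc k)) x :=
  (hτ.differentiable (x, u)).hasFDerivAt.comp x (hasFDerivAt_prodMk_left x u)

/-- The restriction to the zero section does not increase distances. -/
theorem lipschitz_zero_section :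
    LipschitzWith 1 fun x => (τ (x, 0)).1 := by
  have h1 (x : BaseSpc m) := (hτ.hasFDerivAt_slice x 0).fst
  refine lipschitzWith_of_nnnorm_fderiv_le (𝕜 := ℝ) (fun x => (h1 x).differentiableAt) fun x => ?_
  rw [(h1 x).fderiv, ← NNReal.coe_le_coe, coe_nnnorm]
  refine ContinuousLinearMap.opNorm_le_bound _ zero_le_one fun Y => ?_
  rw [NNReal.coe_one, one_mul]
  refine le_of_sq_le_sq ?_ (norm_nonneg _)
  have h2 := hτ.preserves (x, 0) (Y, 0) (Y, 0)
  rw [bundleMetric_self, bundleMetric_self, liftFibre_of_snd_eq_zero br φ rfl] at h2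
  simp only [sub_zero, norm_zero] at h2
  change ‖(fderiv ℝ τ (x, 0) (Y, 0)).1‖ ^ 2 ≤ ‖Y‖ ^ 2
  nlinarith [sq_nonneg ‖(fderiv ℝ τ (x, 0) (Y, 0)).2 -
    liftFibre br' φ (τ (x, 0)) (fderiv ℝ τ (x, 0) (Y, 0)).1‖]

theorem exists_affine_fst (hc : CarriesOrbits τ) :
    ∃ (A : BaseSpc m ≃ₗᵢ[ℝ] BaseSpc m) (b : BaseSpc m), ∀ x u, (τ (x, u)).1 = A x + b := by
  obtain ⟨σ, hσ, h1, h2⟩ := hτ.smooth_inverse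
  have hσ' := hτ.inverse hσ h1 h2
  have hc' := hc.inverse h1 h2
  have h3 (x : BaseSpc m) : (σ ((τ (x, 0)).1, 0)).1 = x := by
    have h3 : ((τ (x, 0)).1, 0) = τ (x, 0) := Prod.ext rfl (hc.snd_eq_zero x).symm
    rw [h3, h1]
  have h4 (x : BaseSpc m) : (τ ((σ (x, 0)).1, 0)).1 = x := by
    have h4 : ((σ (x, 0)).1, 0) = σ (x, 0) := Prod.ext rfl (hc'.snd_eq_zero x).symm
    rw [h4, h2]
  -- Both $\tau$ and its inverse are 1-Lipschitz along the zero section; surjective isometries of a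
  -- Euclidean space are affine.
  have hiso : Isometry fun x => (τ (x, 0)).1 := by
    refine Isometry.of_dist_eq fun x y => le_antisymm ?_ ?_
    · simpa using (hτ.lipschitz_zero_section).dist_le_mul x y
    · simpa [h3] using (hσ'.lipschitz_zero_section).dist_le_mul (τ (x, 0)).1 (τ (y, 0)).1
  let e : BaseSpc m ≃ᵢ BaseSpc m :=
    ⟨⟨fun x => (τ (x, 0)).1, fun x => (σ (x, 0)).1, h3, h4⟩, hiso⟩
  refine ⟨e.toRealAffineIsometryEquiv.linearIsometryEquiv, e 0, fun x u => ?_⟩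
  have h5 := e.toRealAffineIsometryEquiv.map_vadd 0 x
  rw [vadd_eq_add, vadd_eq_add, add_zero, IsometryEquiv.coeFn_toRealAffineIsometryEquiv] at h5
  rw [hτ.fst_eq hc, ← h5]
  rfl

/-- Horizontal vectors are mapped to horizontal vectors. -/
theorem fderiv_lift (hc : CarriesOrbits τ) {A : BaseSpc m ≃ₗᵢ[ℝ] BaseSpc m} {b : BaseSpc m}
    (hA : ∀ x u, (τ (x, u)).1 = A x + b) (x : BaseSpc m) (u : FibreSpc k) (Y : BaseSpc m) :
    (fderiv ℝ τ (x, u) (Y, 0)).2 + (τ (x, liftFibre br φ (x, u) Y)).2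
      = liftFibre br' φ (τ (x, u)) (A Y) := by
  have hfst (v : TotalSpc m k) : (fderiv ℝ τ (x, u) v).1 = A v.1 := by
    have h1 := (hτ.differentiable (x, u)).hasFDerivAt.fst
    have h2 : HasFDerivAt (fun p : TotalSpc m k => A p.1 + b)
        ((A.toContinuousLinearEquiv : BaseSpc m →L[ℝ] BaseSpc m) ∘L
          ContinuousLinearMap.fst ℝ (BaseSpc m) (FibreSpc k)) (x, u) :=
      (((A.toContinuousLinearEquiv : BaseSpc m →L[ℝ] BaseSpc m) ∘L
        ContinuousLinearMap.fst ℝ (BaseSpc m) (FibreSpc k)).hasFDerivAt).add_const b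
    have h3 : (fun p : TotalSpc m k => (τ p).1) = fun p => A p.1 + b := by
      funext p
      exact hA p.1 p.2
    rw [h3] at h1
    exact congrArg (fun e : TotalSpc m k →L[ℝ] BaseSpc m => e v) (h1.unique h2)
  have hvert (W : FibreSpc k) : fderiv ℝ τ (x, u) (0, W) = (0, (τ (x, W)).2) := by
    refine Prod.ext (by rw [hfst, map_zero]) ?_
    have h1 : HasFDerivAt (fun u => (τ (x, u)).2)
        ((ContinuousLinearMap.snd ℝ (BaseSpc m) (FibreSpc k) ∘L fderiv ℝ τ (x, u)) ∘L
          ContinuousLinearMap.inr ℝ (BaseSpc m) (FibreSpc k)) u :=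
      (hτ.differentiable (x, u)).hasFDerivAt.snd.comp u (hasFDerivAt_prodMk_right x u)
    have h2 : HasFDerivAt (fun u => (τ (x, u)).2)
        ((ContinuousLinearMap.snd ℝ (BaseSpc m) (FibreSpc k) ∘L fderiv ℝ τ (x, 0)) ∘L
          ContinuousLinearMap.inr ℝ (BaseSpc m) (FibreSpc k)) u := by
      have h3 : (fun u => (τ (x, u)).2) =
          ((ContinuousLinearMap.snd ℝ (BaseSpc m) (FibreSpc k) ∘L fderiv ℝ τ (x, 0)) ∘L
            ContinuousLinearMap.inr ℝ (BaseSpc m) (FibreSpc k)) := by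
        funext W
        exact hτ.snd_eq_fderiv hc x W
      rw [h3]
      exact ContinuousLinearMap.hasFDerivAt _
    rw [hτ.snd_eq_fderiv hc x W]
    exact congrArg (fun e : FibreSpc k →L[ℝ] FibreSpc k => e W) (h1.unique h2)
  obtain ⟨σ, hσ, h1, h2⟩ := hτ.smooth_inverse
  -- Every vertical vector is the image of a vertical one, so orthogonality to all vertical vectors
  -- carries over.
  have hsurj (W : FibreSpc k) : ∃ V, (τ (x, V)).2 = W := by
    refine ⟨(σ (A x + b, W)).2, ?_⟩
    have h3 := h2 (A x + b, W)
    have h4 : (σ (A x + b, W)).1 = x := by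
      have h5 := hA (σ (A x + b, W)).1 (σ (A x + b, W)).2
      rw [Prod.mk.eta, h3] at h5
      exact (A.injective (add_right_cancel h5)).symm
    have h5 : (x, (σ (A x + b, W)).2) = σ (A x + b, W) := Prod.ext h4.symm rfl
    rw [h5, h3]
  have h3 := (bundleMetric_horizontal_iff br' φ (τ (x, u))
    (fderiv ℝ τ (x, u) (Y, liftFibre br φ (x, u) Y))).mp fun W => by
      obtain ⟨V, rfl⟩ := hsurj W
      rw [← hvert, hτ.preserves]
      exact (bundleMetric_horizontal_iff br φ (x, u) _).mpr rfl V
  have h4 : (fderiv ℝ τ (x, u) (Y, liftFibre br φ (x, u) Y)).2 = _ := congrArg Prod.snd h3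
  dsimp only at h4
  rw [hfst] at h4
  rw [← h4, ← Prod.fst_add_snd (Y, liftFibre br φ (x, u) Y), map_add, hvert]
  rfl

/-- The vertical part of the isometry does not depend on the base point. -/
theorem snd_eq (hφ : IsCutoff φ) (hc : CarriesOrbits τ) (x y : BaseSpc m) (u : FibreSpc k) :
    (τ (x, u)).2 = (τ (y, u)).2 := by
  obtain ⟨A, b, hA⟩ := hτ.exists_affine_fst hc
  have h1 (u : FibreSpc k) (x : BaseSpc m) := (hτ.hasFDerivAt_slice x u).snd
  refine is_const_of_fderiv_eq_zero (𝕜 := ℝ) (f := fun x => (τ (x, u)).2)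
    (fun x => (h1 u x).differentiableAt) (fun x => ?_) x y
  rcases eq_or_ne u 0 with rfl | hu
  · simp only [hc.snd_eq_zero]
    simp
  obtain ⟨M, hM, hφM⟩ := hφ.exists_bound
  have hu0 : 0 < ‖u‖ := norm_pos_iff.mpr hu
  -- This scaling gives $\|cu\|=M+1$, whose square exceeds $M$, so both lifts vanish at $cu$.
  let c : ℝ := (M + 1) / ‖u‖
  have hc0 : 0 < c := by positivity
  have hcu : M < ‖c • u‖ ^ 2 := by
    have h2 : ‖c • u‖ = M + 1 := by
      rw [norm_smul, Real.norm_of_nonneg hc0.le, div_mul_cancel₀ _ hu0.ne']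
    rw [h2]
    nlinarith
  have h2 : fderiv ℝ (fun x => (τ (x, c • u)).2) x = 0 := by
    rw [(h1 (c • u) x).fderiv]
    ext1 Y
    have h3 := hτ.fderiv_lift hc hA x (c • u) Y
    rw [liftFibre, liftFibre, hτ.norm_snd hc, hφM _ _ (sq_nonneg _) (sq_nonneg _) (Or.inr hcu),
      hφM _ _ (sq_nonneg _) (sq_nonneg _) (Or.inr hcu), zero_smul, zero_smul, hc.snd_eq_zero,
      add_zero] at h3
    exact h3
  simp only [hτ.snd_smul hc] at h2
  rw [fderiv_fun_const_smul (h1 u x).differentiableAt] at h2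
  exact (smul_eq_zero.mp h2).resolve_left hc0.ne'

/-- Orbit-preserving isometries are products of affine and linear isometries. -/
theorem exists_product (hφ : IsCutoff φ) (hc : CarriesOrbits τ) :
    ∃ (A : BaseSpc m ≃ₗᵢ[ℝ] BaseSpc m) (b : BaseSpc m) (D : FibreSpc k ≃ₗᵢ[ℝ] FibreSpc k),
      (∀ x u, τ (x, u) = (A x + b, D u)) ∧
      ∀ x u Y, D (liftFibre br φ (x, u) Y) = liftFibre br' φ (A x + b, D u) (A Y) := by
  obtain ⟨A, b, hA⟩ := hτ.exists_affine_fst hc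
  let L : FibreSpc k →ₗᵢ[ℝ] FibreSpc k :=
    { toLinearMap := ((ContinuousLinearMap.snd ℝ (BaseSpc m) (FibreSpc k) ∘L fderiv ℝ τ (0, 0)) ∘L
        ContinuousLinearMap.inr ℝ (BaseSpc m) (FibreSpc k) : FibreSpc k →L[ℝ] FibreSpc k)
      norm_map' := fun u => by
        rw [← hτ.norm_snd hc 0 u, hτ.snd_eq_fderiv hc]
        rfl }
  have hL (x : BaseSpc m) (u : FibreSpc k) : (τ (x, u)).2 = L.toLinearIsometryEquiv rfl u := by
    rw [hτ.snd_eq hφ hc x 0, hτ.snd_eq_fderiv hc]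
    rfl
  have hτL (x : BaseSpc m) (u : FibreSpc k) :
      τ (x, u) = (A x + b, L.toLinearIsometryEquiv rfl u) := Prod.ext (hA x u) (hL x u)
  refine ⟨A, b, L.toLinearIsometryEquiv rfl, hτL, fun x u Y => ?_⟩
  have h1 := hτ.fderiv_lift hc hA x u Y
  have h2 : (fderiv ℝ τ (x, u) (Y, 0)).2 = 0 := by
    have h3 := (hτ.hasFDerivAt_slice x u).snd.fderiv
    have h4 : (fun x => (τ (x, u)).2) = fun _ => L.toLinearIsometryEquiv rfl u :=
      funext fun x => hL x u
    rw [h4, fderiv_fun_const] at h3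
    exact (congrArg (fun e : BaseSpc m →L[ℝ] FibreSpc k => e Y) h3).symm
  rwa [h2, zero_add, hL, hτL] at h1

end IsRiemannianIsometry

/-! ### Comparison of the two brackets -/

/-- If a nonzero linear map, cut off radially, agrees up to a translation with another one, cut off
by the same function, then the translation is trivial and the two maps are equal. -/
theorem eq_of_radial_cutoff_translate {E F : Type*} [NormedAddCommGroup E] [InnerProductSpace ℝ E]
    [AddCommGroup F] [Module ℝ F] {L L' : E →ₗ[ℝ] F} (hL : L ≠ 0) {f : ℝ → ℝ} {M : ℝ}
    (hf : ∃ r, 0 < r ∧ f r ≠ 0) (hM : ∀ r, 0 ≤ r → f r ≠ 0 → r ≤ M) {a : E}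
    (h : ∀ x, f ‖x + a‖ • L' (x + a) = f ‖x‖ • L x) : a = 0 ∧ L' = L := by
  have ha : a = 0 := by
    let N : Set ℝ := {r | 0 ≤ r ∧ f r ≠ 0}
    have hN : BddAbove N := ⟨M, fun r hr => hM r hr.1 hr.2⟩
    obtain ⟨x₀, hx₀⟩ : ∃ x, L x ≠ 0 := by
      by_contra! h0
      exact hL (LinearMap.ext h0)
    have hx₀' : 0 < ‖x₀‖ := norm_pos_iff.mpr fun h0 => hx₀ (by rw [h0, map_zero])
    obtain ⟨x₁, hx₁, hx₁n, hx₁a⟩ : ∃ x, L x ≠ 0 ∧ ‖x‖ = ‖x₀‖ ∧ 0 ≤ inner ℝ x a := by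
      rcases le_total 0 (inner ℝ x₀ a) with h0 | h0
      · exact ⟨x₀, hx₀, rfl, h0⟩
      · exact ⟨-x₀, by simpa using hx₀, norm_neg _, by simpa [inner_neg_left] using h0⟩
    -- At $cx_1$, of norm $r$, the right side of `h` is nonzero, so $\|cx_1+a\|$ is again a radius
    -- where `f` is nonzero. As $\langle x_1,a\rangle\ge0$, its square is at least $r^2+\|a\|^2$;
    -- letting $r$ approach the supremum forces $a=0$.
    have key (r : ℝ) (hr : 0 < r) (hfr : f r ≠ 0) : r ^ 2 + ‖a‖ ^ 2 ≤ sSup N ^ 2 := by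
      let c : ℝ := r / ‖x₀‖
      have hc : 0 < c := div_pos hr hx₀'
      have hn : ‖c • x₁‖ = r := by
        rw [norm_smul, Real.norm_of_nonneg hc.le, hx₁n, div_mul_cancel₀ _ hx₀'.ne']
      have h1 : f ‖c • x₁ + a‖ ≠ 0 := by
        intro h0
        have h2 := h (c • x₁)
        rw [h0, zero_smul, hn, map_smul, eq_comm, smul_eq_zero, smul_eq_zero] at h2
        rcases h2 with h2 | h2 | h2
        · exact hfr h2
        · exact hc.ne' h2
        · exact hx₁ h2
      have h2 : ‖c • x₁ + a‖ ≤ sSup N := le_csSup hN ⟨norm_nonneg _, h1⟩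
      have h3 : r ^ 2 + ‖a‖ ^ 2 ≤ ‖c • x₁ + a‖ ^ 2 := by
        rw [norm_add_sq_real, hn, real_inner_smul_left]
        nlinarith [mul_nonneg hc.le hx₁a]
      exact h3.trans (pow_le_pow_left₀ (norm_nonneg _) h2 2)
    obtain ⟨r, hr, hfr⟩ := hf
    have hr' := key r hr hfr
    have h1 : sSup N ≤ √(sSup N ^ 2 - ‖a‖ ^ 2) := by
      refine csSup_le ⟨r, hr.le, hfr⟩ fun s hs => ?_
      rcases hs.1.eq_or_lt with rfl | hs0
      · exact Real.sqrt_nonneg _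
      · refine Real.le_sqrt_of_sq_le ?_
        linarith [key s hs0 hs.2]
    have h2 : 0 ≤ sSup N := hr.le.trans (le_csSup hN ⟨hr.le, hfr⟩)
    have h3 := pow_le_pow_left₀ h2 h1 2
    rw [Real.sq_sqrt (by nlinarith)] at h3
    rw [← norm_eq_zero, ← sq_eq_zero_iff]
    nlinarith [sq_nonneg ‖a‖]
  subst ha
  refine ⟨rfl, LinearMap.ext fun x => ?_⟩
  rcases eq_or_ne x 0 with rfl | hx
  · rw [map_zero, map_zero]
  obtain ⟨r, hr, hfr⟩ := hf
  have hx' : 0 < ‖x‖ := norm_pos_iff.mpr hx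
  have hc : r / ‖x‖ ≠ 0 := (div_pos hr hx').ne'
  have h1 := h ((r / ‖x‖) • x)
  have hn : ‖(r / ‖x‖) • x‖ = r := by
    rw [norm_smul, Real.norm_of_nonneg (div_pos hr hx').le, div_mul_cancel₀ _ hx'.ne']
  rw [add_zero, hn, map_smul, map_smul] at h1
  exact smul_right_injective F hc (smul_right_injective F hfr h1)

theorem exists_norm_sq_eq_ne_zero {k : ℕ} (hk : k ≠ 0) {t : ℝ} (ht : 0 < t) :
    ∃ u : FibreSpc k, ‖u‖ ^ 2 = t ∧ ∀ j, u j ≠ 0 := by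
  have hk' : (0 : ℝ) < k := by positivity
  refine ⟨WithLp.toLp 2 fun _ => (√(t / k) : ℂ), ?_, fun j => ?_⟩
  · rw [PiLp.norm_sq_eq_of_L2]
    simp only [Complex.norm_real, Real.norm_eq_abs, sq_abs,
      Real.sq_sqrt (div_pos ht hk').le, Finset.sum_const, Finset.card_univ, Fintype.card_fin,
      nsmul_eq_mul]
    field_simp
  · exact Complex.ofReal_ne_zero.mpr (Real.sqrt_pos.mpr (div_pos ht hk')).ne'

theorem proposition4p6 (m k : ℕ) (φ : ℝ → ℝ → ℝ) (hφ : IsCutoff φ)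
    (hφ0 : ∃ s t : ℝ, 0 ≤ s ∧ 0 ≤ t ∧ φ s t ≠ 0)
    (br br' : BilinBracket m k) (hbr : br ≠ 0) (hbr' : br' ≠ 0) :
    (∀ τ : TotalSpc m k → TotalSpc m k,
      IsRiemannianIsometry (bundleMetric br φ) (bundleMetric br' φ) τ → CarriesOrbits τ →
        ∃ (A : BaseSpc m ≃ₗᵢ[ℝ] BaseSpc m) (D : FibreSpc k ≃ₗᵢ[ℝ] FibreSpc k),
          (∀ x u, τ (x, u) = (A x, D u)) ∧
          D ∈ Subgroup.normalizer (torus k : Set (FibreSpc k ≃ₗᵢ[ℝ] FibreSpc k)) ∧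
          ∃ C : TorusLie k ≃ₗᵢ[ℝ] TorusLie k,
            IsConjugationOnLie D C ∧ IsBracketEquivalence br br' A C.symm) ∧
    (∀ (A : BaseSpc m ≃ₗᵢ[ℝ] BaseSpc m) (D : FibreSpc k ≃ₗᵢ[ℝ] FibreSpc k)
      (C : TorusLie k ≃ₗᵢ[ℝ] TorusLie k),
        D ∈ Subgroup.normalizer (torus k : Set (FibreSpc k ≃ₗᵢ[ℝ] FibreSpc k)) →
        IsConjugationOnLie D C → IsBracketEquivalence br br' A C.symm →
        IsRiemannianIsometry (bundleMetric br φ) (bundleMetric br' φ)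
          (fun p => (A p.1, D p.2))) := by
  refine ⟨fun τ hτ hc => ?_, fun A D C _ hD h => h.isRiemannianIsometry hD φ⟩
  obtain ⟨A, b, D, hτD, hlift⟩ := hτ.exists_product hφ hc
  have horb (u : FibreSpc k) := hc.image_torusOrbit ((0 : BaseSpc m), u)
  obtain ⟨C, hDC, hCL⟩ := exists_isConjugationOnLie D
    (fun u z hz => by
      have h1 : τ (0, z u) ∈ torusOrbit (τ (0, u)) := by
        rw [← horb]
        exact ⟨_, ⟨z, hz, rfl⟩, rfl⟩
      obtain ⟨z', hz', h2⟩ := h1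
      rw [hτD, hτD] at h2
      exact ⟨z', hz', congrArg Prod.snd h2⟩)
    (fun u z hz => by
      have h1 : (A 0 + b, z (D u)) ∈ τ '' torusOrbit (0, u) := by
        rw [horb, hτD]
        exact ⟨z, hz, rfl⟩
      obtain ⟨_, ⟨z', hz', rfl⟩, h2⟩ := h1
      rw [hτD] at h2
      exact ⟨z', hz', (congrArg Prod.snd h2).symm⟩)
  have hk : k ≠ 0 := by
    rintro rfl
    exact hbr (LinearMap.ext₂ fun x y => Subsingleton.elim _ _)
  obtain ⟨s, t, hs, ht, hst⟩ := hφ.exists_pos_ne_zero hφ0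
  obtain ⟨u, hu, hu0⟩ := exists_norm_sq_eq_ne_zero hk ht
  let B : BilinBracket m k :=
    ((br'.compl₁₂ A.toLinearEquiv.toLinearMap A.toLinearEquiv.toLinearMap).compr₂
      C.symm.toLinearEquiv.toLinearMap)
  have hB (x y : BaseSpc m) : B x y = C.symm (br' (A x) (A y)) := rfl
  obtain ⟨M, hM0, hM⟩ := hφ.exists_bound
  -- Substituting $a=A^{-1}b$ turns $Ax+b$ into $A(x+a)$. The bound $M+1$ works because $r>M+1$
  -- implies $r^2>M$.
  obtain ⟨hb, hBbr⟩ := eq_of_radial_cutoff_translate (L := br) (L' := B) hbr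
    (f := fun r => φ (r ^ 2) t) (M := M + 1) (a := A.symm b)
    ⟨√s, Real.sqrt_pos.mpr hs, by rwa [Real.sq_sqrt hs.le]⟩
    (fun r hr hfr => by
      by_contra! hlt
      exact hfr (hM _ _ (sq_nonneg r) ht.le (Or.inl (by nlinarith))))
    (fun x => by
      ext1 y
      have h1 := hlift x u y
      have h2 : ‖A x + b‖ = ‖x + A.symm b‖ := by
        rw [← A.norm_map (x + A.symm b), map_add, A.apply_symm_apply]
      rw [liftFibre, liftFibre, D.norm_map, hu, h2, ← C.apply_symm_apply (br' (A x + b) (A y)),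
        ← hDC.apply_fundField, ← D.map_smul, ← fundField_smul_left, ← fundField_smul_left] at h1
      -- No coordinate of `u` vanishes, so equal fundamental vectors at `u` come from equal Lie
      -- algebra elements.
      have h3 := fundField_injective hu0 (D.injective h1)
      rw [LinearMap.smul_apply, LinearMap.smul_apply, hB, map_add, A.apply_symm_apply]
      exact h3.symm)
  have hb0 : b = 0 := by simpa using hb
  subst hb0
  refine ⟨A, D, fun x u => by rw [hτD, add_zero], hDC.mem_normalizer, C, hDC, ?_, ?_⟩
  · conv_lhs => rw [← hCL]
    rw [← Set.image_comp]
    simp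
  · intro x y Z
    rw [← hBbr, hB, C.symm.inner_map_map]
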